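/- Let $(X,\mathcal F,m)$ be a $\sigma$-finite measure space, and let $\mathcal E : L^2(X,m)\to[0,\infty]$ (real-valued functions) be a nonlinear Dirichlet form: $\mathcal E$ is convex, lower semicontinuous, its domain $D(\mathcal E)=\{u\in L^2(X,m) : \mathcal E(u)\neq\infty\}$ is dense in $L^2(X,m)$, and the semigroup $(T_t)_{t\ge 0}$ generated by $-\partial\mathcal E$ is a nonlinear Markov semigroup. Here $$\partial\mathcal E(u)=\Big\{\xi\in L^2(X,m) : \mathcal E(z)-\mathcal E(u)\ge \int_X \xi\,(z-u)\,dm\ \ \forall z\in L^2(X,m)\Big\}\qquad (u\in D(\mathcal E))$$ is the subdifferential; $(T_t)_{t\ge0}$ is the gradient flow, i.e. for every $u\in L^2(X,m)$ the curve $t\mapsto T_tu$ is continuous on $[0,\infty)$ with $T_0u=u$, and for every $t>0$ its right derivative exists and belongs to $-\partial\mathcal E(T_tu)$; and it is Markov if $\|T_tu-T_tv\|_{L^p}\le\|u-v\|_{L^p}$ for all $t\ge 0$, $p\in[1,\infty]$, $u,v\in L^2(X,m)$, and $u\ge v$ implies $T_tu\ge T_tv$. Assume that $\mathcal E$ is $2$-homogeneous: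 $\mathcal E(\nu u)=\nu^2\mathcal E(u)$ for all $\nu\in\mathbb R$, $u\in L^2(X,m)$ (with $0\cdot\infty=0$). Then the following hold. 1. $D(\mathcal E)$ is a vector subspace of $L^2(X,m)$, and $\|u\|_{\mathcal E}:=\big(\|u\|_{L^2(X,m)}^2+\mathcal E(u)\big)^{1/2}$ is a norm on $D(\mathcal E)$ for which $D(\mathcal E)$ is a Banach space. 2. $(D(\mathcal E),\|\cdot\|_{\mathcal E})$ is a Hilbert space if and only if $\mathcal E$ is a quadratic Dirichlet form, i.e. $\mathcal E$ is lower semicontinuous, $D(\mathcal E)$ is a dense linear subspace on which $\mathcal E$ is a quadratic form, and $\mathcal E(0\vee u\wedge 1)\le\mathcal E(u)$ for all $u\in D(\mathcal E)$. 3. For every Lipschitz function $\phi:\mathbb R\to\mathbb R$ with $\phi(0)=0$ and every $u\in D(\mathcal E)$, one has $\phi\circ u\in D(\mathcal E)$. Moreover, $D(\mathcal E)\cap L^\infty(X,m)$ is an algebra: it is a vector space closed under pointwise (a.e.) multiplication. 4. $(D(\mathcal E),\|\cdot\|_{\mathcal E})$ is a dual space: there are a real Banach space $Y$ and a linear isometric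 isomorphism of $(D(\mathcal E),\|\cdot\|_{\mathcal E})$ onto the dual $Y^*$. -/

import Mathlib

open MeasureTheory Set Filter Topology
open scoped ENNReal NNReal

universe u

namespace NonlinearDirichlet

section Functionals

variable {X : Type*} [MeasurableSpace X] {m : Measure X}

/-- The effective domain `D(E) = {u ∈ L² : E(u) ≠ ∞}`. -/
def domain (E : Lp ℝ 2 m → ℝ≥0∞) : Set (Lp ℝ 2 m) := {u | E u ≠ ∞}

/-- The subdifferential of `E` in `L²`: `ξ ∈ ∂E(u)` iff `u ∈ D(E)` and
`E(u) + (ξ, z - u) ≤ E(z)` for all `z ∈ L²`. -/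
def subdifferential (E : Lp ℝ 2 m → ℝ≥0∞) (u : Lp ℝ 2 m) : Set (Lp ℝ 2 m) :=
  {ξ | u ∈ domain E ∧
    ∀ z : Lp ℝ 2 m, (E u : EReal) + ((inner ℝ ξ (z - u) : ℝ) : EReal) ≤ (E z : EReal)}

/-- `T` (of which only the times `t ≥ 0` matter) is the semigroup generated by `-∂E`: for every
`u`, the curve `t ↦ T t u` is continuous on `[0, ∞)`, starts at `u` and satisfies
`∂ₜ (T t u) ∈ -∂E (T t u)` for every `t > 0`. As usual for gradient flows of nonsmooth convex
functionals, `∂ₜ` is the derivative from the right. -/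
structure IsGradientFlow (E : Lp ℝ 2 m → ℝ≥0∞) (T : ℝ → Lp ℝ 2 m → Lp ℝ 2 m) : Prop where
  initial : ∀ u, T 0 u = u
  continuousOn : ∀ u, ContinuousOn (fun t => T t u) (Ici 0)
  equation : ∀ u, ∀ t : ℝ, 0 < t →
    ∃ ξ ∈ subdifferential E (T t u), HasDerivWithinAt (fun s => T s u) (-ξ) (Ici t) t

/-- A nonlinear Markov semigroup: order preserving, and a contraction (a nonexpansive map) for
every `L^p` norm, `1 ≤ p ≤ ∞`. -/
structure IsMarkov (T : ℝ → Lp ℝ 2 m → Lp ℝ 2 m) : Prop where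
  contraction : ∀ t : ℝ, 0 ≤ t → ∀ p : ℝ≥0∞, 1 ≤ p → ∀ u v : Lp ℝ 2 m,
    eLpNorm (T t u - T t v : Lp ℝ 2 m) p m ≤ eLpNorm (u - v : Lp ℝ 2 m) p m
  monotone : ∀ t : ℝ, 0 ≤ t → ∀ u v : Lp ℝ 2 m, v ≤ u → T t v ≤ T t u

/-- A nonlinear Dirichlet form: a convex, lower semicontinuous functional with dense domain such
that the semigroup generated by `-∂E` is a nonlinear Markov semigroup. (That semigroup is unique
at times `t ≥ 0`: see `IsGradientFlow.unique` below.) -/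
structure IsNonlinearDirichletForm (E : Lp ℝ 2 m → ℝ≥0∞) : Prop where
  convex : ConvexOn ℝ≥0 univ E
  lsc : LowerSemicontinuous E
  dense : Dense (domain E)
  markov : ∃ T : ℝ → Lp ℝ 2 m → Lp ℝ 2 m, IsGradientFlow E T ∧ IsMarkov T

/-- `E(ν u) = ν² E(u)` for all real `ν` (with `0 · ∞ = 0`). -/
def IsTwoHomogeneous (E : Lp ℝ 2 m → ℝ≥0∞) : Prop :=
  ∀ (ν : ℝ) (u : Lp ℝ 2 m), E (ν • u) = ENNReal.ofReal (ν ^ 2) * E u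

/-- `E` is quadratic: its domain is a linear subspace, on which `E` is a quadratic form. -/
def IsQuadratic (E : Lp ℝ 2 m → ℝ≥0∞) : Prop :=
  ∃ (D : Submodule ℝ (Lp ℝ 2 m)) (Q : QuadraticForm ℝ D),
    (D : Set (Lp ℝ 2 m)) = domain E ∧ ∀ u : D, (E u).toReal = Q u

theorem lipschitzWith_clip : LipschitzWith 1 (fun x : ℝ => min (max 0 x) 1) :=
  (LipschitzWith.id.const_max 0).min_const 1

/-- The unit contraction `0 ∨ u ∧ 1` of `u ∈ L²`. -/
noncomputable def unitClip (u : Lp ℝ 2 m) : Lp ℝ 2 m :=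
  lipschitzWith_clip.compLp (by simp) u

/-- A quadratic Dirichlet form: quadratic, lower semicontinuous, densely defined, and
`E(0 ∨ u ∧ 1) ≤ E(u)` on its domain. -/
structure IsQuadraticDirichletForm (E : Lp ℝ 2 m → ℝ≥0∞) : Prop where
  quadratic : IsQuadratic E
  lsc : LowerSemicontinuous E
  dense : Dense (domain E)
  clip : ∀ u ∈ domain E, E (unitClip u) ≤ E u

/-- `‖u‖_E = (‖u‖²_{L²} + E(u))^{1/2}`; meaningful for `u ∈ D(E)`. -/
noncomputable def energyNorm (E : Lp ℝ 2 m → ℝ≥0∞) (u : Lp ℝ 2 m) : ℝ :=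
  Real.sqrt (‖u‖ ^ 2 + (E u).toReal)

end Functionals

section Norms

variable {V : Type*} [AddCommGroup V] [Module ℝ V]

/-- `N` is a norm on the real vector space `V`. -/
structure IsNorm (N : V → ℝ) : Prop where
  nonneg : ∀ u, 0 ≤ N u
  eq_zero_iff : ∀ u, N u = 0 ↔ u = 0
  smul : ∀ (a : ℝ) (u : V), N (a • u) = |a| * N u
  add_le : ∀ u v, N (u + v) ≤ N u + N v

/-- `(V, N)` is a Banach space: `N` is a norm for which every Cauchy sequence converges. -/
structure IsBanach (N : V → ℝ) : Prop extends IsNorm N where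
  complete : ∀ x : ℕ → V,
    (∀ ε : ℝ, 0 < ε → ∃ n₀ : ℕ, ∀ n ≥ n₀, ∀ k ≥ n₀, N (x n - x k) < ε) →
      ∃ y : V, Tendsto (fun n => N (x n - y)) atTop (𝓝 0)

/-- `(V, N)` is a Hilbert space: it is a Banach space and `N` comes from a scalar product. -/
def IsHilbert (N : V → ℝ) : Prop :=
  IsBanach N ∧ ∃ B : LinearMap.BilinForm ℝ V, (∀ u v, B u v = B v u) ∧ ∀ u, N u ^ 2 = B u u

end Norms

section Uniqueness

variable {X : Type*} [MeasurableSpace X] {m : Measure X}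

theorem inner_nonneg_of_mem_subdifferential {E : Lp ℝ 2 m → ℝ≥0∞} {u v ξ η : Lp ℝ 2 m}
    (hξ : ξ ∈ subdifferential E u) (hη : η ∈ subdifferential E v) :
    0 ≤ inner ℝ (u - v) (ξ - η) := by
  obtain ⟨hu, h1⟩ := hξ
  obtain ⟨hv, h2⟩ := hη
  have h1 := h1 v
  have h2 := h2 u
  simp only [domain, mem_ofPred_eq] at hu hv
  lift E u to ℝ≥0 using hu with a
  lift E v to ℝ≥0 using hv with b
  rw [EReal.coe_nnreal_eq_coe_real, EReal.coe_nnreal_eq_coe_real] at h1 h2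
  norm_cast at h1 h2
  simp only [inner_sub_right, inner_sub_left] at *
  rw [real_inner_comm ξ u, real_inner_comm ξ v, real_inner_comm η u, real_inner_comm η v]
  linarith

/-- At times `t ≥ 0` there is at most one semigroup generated by `-∂E`. -/
theorem IsGradientFlow.unique {E : Lp ℝ 2 m → ℝ≥0∞} {T S : ℝ → Lp ℝ 2 m → Lp ℝ 2 m}
    (hT : IsGradientFlow E T) (hS : IsGradientFlow E S) {t : ℝ} (ht : 0 ≤ t) (u : Lp ℝ 2 m) :
    T t u = S t u := by
  set f : ℝ → ℝ := fun s => ‖T s u - S s u‖ ^ 2 with hf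
  have hc : ContinuousOn f (Ici 0) := ((hT.continuousOn u).sub (hS.continuousOn u)).norm.pow 2
  have h0 : f 0 = 0 := by simp [hf, hT.initial, hS.initial]
  rcases ht.eq_or_lt with rfl | htpos
  · rw [hT.initial, hS.initial]
  have key : ∀ s, 0 < s → s ≤ t → f t ≤ f s := by
    intro s hs hst
    have hd : ∀ r ∈ Ico s t, ∃ f' ≤ (0 : ℝ), HasDerivWithinAt f f' (Ici r) r := by
      intro r hr
      obtain ⟨ξ, hξ, dξ⟩ := hT.equation u r (hs.trans_le hr.1)
      obtain ⟨η, hη, dη⟩ := hS.equation u r (hs.trans_le hr.1)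
      refine ⟨_, ?_, (dξ.sub dη).norm_sq⟩
      have := inner_nonneg_of_mem_subdifferential hξ hη
      have e : -ξ - -η = -(ξ - η) := by abel
      rw [e, inner_neg_right]
      simp only [Pi.sub_apply]
      linarith
    choose! f' hf' hfd using hd
    exact image_le_of_deriv_right_le_deriv_boundary (B := fun _ => f s) (B' := fun _ => 0)
      (hc.mono fun r hr => hs.le.trans hr.1) hfd le_rfl continuousOn_const
      (fun r _ => hasDerivWithinAt_const _ _ _) hf' ⟨hst, le_rfl⟩
  have hlim : Tendsto f (𝓝[>] 0) (𝓝 (f 0)) :=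
    (hc 0 self_mem_Ici).mono_left (nhdsWithin_mono _ Ioi_subset_Ici_self)
  have hle : f t ≤ f 0 := by
    refine ge_of_tendsto hlim ?_
    filter_upwards [Ioc_mem_nhdsGT htpos] with s hs using key s hs.1 hs.2
  have hz : ‖T t u - S t u‖ ^ 2 ≤ 0 := hle.trans h0.le
  have : ‖T t u - S t u‖ = 0 := by nlinarith [norm_nonneg (T t u - S t u)]
  exact sub_eq_zero.mp (norm_eq_zero.mp this)

end Uniqueness

end NonlinearDirichlet

/-! The engine is a comparison principle, `IsGradientFlow.le_of_inner_nonpos`: while the energy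
along the flow from `w` stays above `E u`, the flow moves strictly closer to `u`. Hence `E w ≤ E u`
as soon as `(T s w - w, u - w) ≤ 0` for all `s > 0`. The Markov property supplies this sign for
contractions `w` of `u`. Order preservation and the `L^∞` bound settle the positive part and the
unit clip pointwise.

For `w = ψ ∘ u` with `u ≥ 0` and both `ψ` and `id - ψ` strictly increasing, `u - w` is an increasing
function of `w`. The `L^1` and `L^∞` contractions make the integral of `T t w - w` over each set `{w
> k}` nonpositive (`IsMarkov.setIntegral_sub_nonpos`), and a layer-cake formula adds these up to the
required sign. Any Lipschitz `φ` is a linear combination of such a `ψ` and the identity, so the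
domain is stable under `φ`; squares of bounded functions and polarization then give the algebra.

The norm statements use only convexity, homogeneity and lower semicontinuity. The energy balls are
closed in `L²`, which yields completeness and, through a bipolar argument, a predual. The Hilbert
criterion amounts to adding or subtracting the `L²` scalar product. -/

namespace NonlinearDirichlet

/-! ### Energy comparison along the gradient flow, and Markov estimates -/

section Flow

variable {X : Type*} [MeasurableSpace X] {m : Measure X} {E : Lp ℝ 2 m → ℝ≥0∞}
  {T : ℝ → Lp ℝ 2 m → Lp ℝ 2 m}

/-- If the flow started at `w` does not approach `u` to first order, then `E w ≤ E u`. -/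
theorem IsGradientFlow.le_of_inner_nonpos (hT : IsGradientFlow E T) (hlsc : LowerSemicontinuous E)
    {u w : Lp ℝ 2 m} (h : ∀ s, 0 < s → inner ℝ (T s w - w) (u - w) ≤ 0) : E w ≤ E u := by
  by_contra! hlt
  obtain ⟨c, huc, hcw⟩ := exists_between hlt
  have hev : ∀ᶠ s in 𝓝[≥] (0 : ℝ), c < E (T s w) := by
    have hc : Tendsto (fun s => T s w) (𝓝[≥] 0) (𝓝 w) := by
      have := hT.continuousOn w 0 self_mem_Ici
      simpa [ContinuousWithinAt, hT.initial] using this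
    exact hc.eventually (hlsc w c hcw)
  obtain ⟨t, ht0, ht⟩ := mem_nhdsGE_iff_exists_Icc_subset.mp hev
  have ht0 : 0 < t := ht0
  lift E u to ℝ≥0 using (huc.trans_le le_top).ne with a ha
  lift c to ℝ≥0 using (hcw.trans_le le_top).ne with c
  have hac : (a : ℝ) < c := by exact_mod_cast huc
  set f : ℝ → ℝ := fun s => ‖T s w - u‖ ^ 2 with hf
  have hcont : ContinuousOn f (Ici 0) := ((hT.continuousOn w).sub continuousOn_const).norm.pow 2
  -- The subgradient inequality tested at `u` bounds the right derivative of `f` by `2 (E u - E (T r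
  -- w))`, which is below `-2 (c - a)`. The flow equation holds only at positive times, so the
  -- estimate starts at `s > 0` and `s → 0` is taken afterwards.
  have key : ∀ s, 0 < s → s ≤ t → f t ≤ f s - 2 * (c - a) * (t - s) := by
    intro s hs hst
    have hd : ∀ r ∈ Ico s t, ∃ f' ≤ -(2 * ((c : ℝ) - a)), HasDerivWithinAt f f' (Ici r) r := by
      intro r hr
      obtain ⟨ξ, ⟨hfin, hξ⟩, dξ⟩ := hT.equation w r (hs.trans_le hr.1)
      refine ⟨_, ?_, (dξ.sub_const u).norm_sq⟩
      have h1 := hξ u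
      have h2 : (c : ℝ≥0∞) < E (T r w) := ht ⟨hs.le.trans hr.1, hr.2.le⟩
      rw [← ha] at h1
      simp only [domain, mem_ofPred_eq] at hfin
      lift E (T r w) to ℝ≥0 using hfin with b
      rw [EReal.coe_nnreal_eq_coe_real, EReal.coe_nnreal_eq_coe_real] at h1
      norm_cast at h1 h2
      have h2' : (c : ℝ) < b := by exact_mod_cast h2
      have e : inner ℝ ξ (u - T r w) = inner ℝ (T r w - u) (-ξ) := by
        rw [inner_neg_right, real_inner_comm, ← inner_neg_left, neg_sub]
      rw [e] at h1
      linarith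
    choose! f' hf' hfd using hd
    have := image_le_of_deriv_right_le_deriv_boundary (f := f) (f' := f') (a := s) (b := t)
      (B := fun r => f s - 2 * (c - a) * (r - s)) (B' := fun _ => -(2 * ((c : ℝ) - a)))
      (hcont.mono fun r hr => hs.le.trans hr.1) hfd (by simp) (by fun_prop)
      (fun r _ => by
        have := (((hasDerivAt_id r).sub_const s).const_mul (2 * ((c : ℝ) - a))).const_sub (f s)
        simpa using this.hasDerivWithinAt) hf' (x := t) ⟨hst, le_rfl⟩
    exact this
  have hlim : Tendsto (fun s => f s - 2 * (c - a) * (t - s)) (𝓝[>] 0)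
      (𝓝 (f 0 - 2 * (c - a) * (t - 0))) := by
    refine Tendsto.sub ?_ ?_
    · exact (hcont 0 self_mem_Ici).mono_left (nhdsWithin_mono _ Ioi_subset_Ici_self)
    · exact (Continuous.tendsto (by fun_prop) 0).mono_left nhdsWithin_le_nhds
  have hle : f t ≤ f 0 - 2 * (c - a) * (t - 0) := by
    refine ge_of_tendsto hlim ?_
    filter_upwards [Ioc_mem_nhdsGT ht0] with s hs using key s hs.1 hs.2
  -- Expanding the square around `w`, the hypothesis on the inner product prevents any decrease of
  -- the distance to `u`.
  have hge : f 0 ≤ f t := by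
    simp only [hf, hT.initial]
    have e : T t w - u = (T t w - w) - (u - w) := by abel
    rw [e, norm_sub_sq_real (T t w - w) (u - w), norm_sub_rev w u]
    nlinarith [h t ht0, sq_nonneg ‖T t w - w‖]
  nlinarith [mul_pos (sub_pos.mpr hac) ht0]

theorem IsTwoHomogeneous.map_zero (hE2 : IsTwoHomogeneous E) : E 0 = 0 := by
  simpa using hE2 0 0

/-- Since `0` minimizes `E`, the constant curve solves the flow equation. Replacing only the
trajectory from `0` by it gives another flow, and uniqueness identifies the two. -/
theorem IsGradientFlow.map_zero (hT : IsGradientFlow E T) (h0 : E 0 = 0) {t : ℝ} (ht : 0 ≤ t) :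
    T t 0 = 0 := by
  classical
  have hS : IsGradientFlow E (fun t u => if u = 0 then 0 else T t u) := by
    refine ⟨fun u => ?_, fun u => ?_, fun u t ht => ?_⟩ <;> by_cases hu : u = 0
    · simp [hu]
    · simp [hu, hT.initial]
    · simpa [hu] using continuousOn_const
    · simpa [hu] using hT.continuousOn u
    · refine ⟨0, ⟨by simp [domain, hu, h0], fun z => ?_⟩, ?_⟩
      · simpa [hu, h0] using EReal.coe_ennreal_nonneg _
      · simpa [hu] using hasDerivWithinAt_const t (Ici t) (0 : Lp ℝ 2 m)
    · simpa [hu] using hT.equation u t ht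
  simpa using hT.unique hS ht 0

theorem IsMarkov.map_nonneg (hM : IsMarkov T) {t : ℝ} (ht : 0 ≤ t) (hT0 : T t 0 = 0)
    {w : Lp ℝ 2 m} (hw : 0 ≤ w) : 0 ≤ T t w := by
  simpa [hT0] using hM.monotone t ht w 0 hw

theorem IsMarkov.ae_abs_le (hM : IsMarkov T) {t : ℝ} (ht : 0 ≤ t) (hT0 : T t 0 = 0)
    {w : Lp ℝ 2 m} {k : ℝ} (hw : ∀ᵐ x ∂m, |w x| ≤ k) : ∀ᵐ x ∂m, |T t w x| ≤ k := by
  have h := hM.contraction t ht ∞ le_top w 0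
  rw [hT0, sub_zero, sub_zero, eLpNorm_exponent_top, eLpNorm_exponent_top] at h
  have h1 : eLpNormEssSup w m ≤ ENNReal.ofReal k :=
    eLpNormEssSup_le_of_ae_bound (by simpa using hw)
  filter_upwards [ae_le_eLpNormEssSup (f := (T t w)) (μ := m), hw] with x hx hk
  have h2 := (hx.trans h).trans h1
  rw [← ofReal_norm] at h2
  exact (ENNReal.ofReal_le_ofReal_iff ((abs_nonneg _).trans hk)).mp h2

theorem inner_sub_sub_nonpos {a b c : Lp ℝ 2 m}
    (h : ∀ᵐ x ∂m, (a x - b x) * (c x - b x) ≤ 0) : inner ℝ (a - b) (c - b) ≤ 0 := by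
  rw [L2.inner_def]
  refine integral_nonpos_of_ae ?_
  filter_upwards [h, Lp.coeFn_sub a b, Lp.coeFn_sub c b] with x hx h1 h2
  rw [h1, h2, Pi.sub_apply, Pi.sub_apply, RCLike.inner_apply, conj_trivial, mul_comm]
  exact hx

/-- Where `u < 0` the positive part vanishes and the flow can only raise it, hence away from `u`;
elsewhere the two functions agree. -/
theorem le_of_posPart (hT : IsGradientFlow E T) (hM : IsMarkov T) (hlsc : LowerSemicontinuous E)
    (h0 : E 0 = 0) (u : Lp ℝ 2 m) : E (Lp.posPart u) ≤ E u := by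
  refine hT.le_of_inner_nonpos hlsc fun s hs => inner_sub_sub_nonpos ?_
  have hp : 0 ≤ Lp.posPart u := by
    rw [← Lp.coeFn_nonneg]
    filter_upwards [Lp.coeFn_posPart u] with x hx
    rw [hx]; exact le_max_right _ _
  have := hM.map_nonneg hs.le (hT.map_zero h0 hs.le) hp
  rw [← Lp.coeFn_nonneg] at this
  filter_upwards [this, Lp.coeFn_posPart u] with x h1 h2
  simp only [Pi.zero_apply] at h1
  rw [h2]
  rcases le_total (u x) 0 with h | h
  · rw [max_eq_right h]; nlinarith
  · rw [max_eq_left h]; simp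

/-- The flow keeps the clipped function in `[0, 1]`. Where clipping was active its value is an
endpoint of this interval, so it can only move away from `u`. -/
theorem le_of_unitClip (hT : IsGradientFlow E T) (hM : IsMarkov T) (hlsc : LowerSemicontinuous E)
    (h0 : E 0 = 0) (u : Lp ℝ 2 m) : E (unitClip u) ≤ E u := by
  refine hT.le_of_inner_nonpos hlsc fun s hs => inner_sub_sub_nonpos ?_
  have hc : unitClip u =ᵐ[m] fun x => min (max 0 (u x)) 1 :=
    lipschitzWith_clip.coeFn_compLp _ u
  have hp : 0 ≤ unitClip u := by
    rw [← Lp.coeFn_nonneg]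
    filter_upwards [hc] with x hx
    rw [hx]; exact le_min (le_max_left _ _) zero_le_one
  have hT0 := hT.map_zero h0 hs.le
  have h1 := hM.map_nonneg hs.le hT0 hp
  have h2 := hM.ae_abs_le hs.le hT0 (w := unitClip u) (k := 1) <| by
    filter_upwards [hc] with x hx
    rw [hx, abs_of_nonneg (le_min (le_max_left _ _) zero_le_one)]; exact min_le_right _ _
  rw [← Lp.coeFn_nonneg] at h1
  filter_upwards [h1, h2, hc] with x h1 h2 h3
  simp only [Pi.zero_apply] at h1
  have h2 := (abs_le.mp h2).2
  rw [h3]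
  rcases le_total (u x) 0 with h | h
  · rw [max_eq_left h, min_eq_left zero_le_one]; nlinarith
  · rw [max_eq_right h]
    rcases le_total (u x) 1 with h' | h'
    · rw [min_eq_left h']; simp
    · rw [min_eq_right h']; nlinarith

/-- Compare `w` with its truncation `v = min w k`. The `L^∞` bound gives `T t v ≤ k`, so the excess
of `T t w` over `k` is at most `|T t w - T t v|`, whose integral the `L^1` contraction bounds by
that of `w - v = (w - k)⁺`. -/
theorem IsMarkov.setIntegral_sub_nonpos (hM : IsMarkov T) {t : ℝ} (ht : 0 ≤ t) (hT0 : T t 0 = 0)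
    {w : Lp ℝ 2 m} (hw : 0 ≤ w) {k : ℝ} (hk : 0 < k) :
    ∫ x in {x | k < w x}, (T t w x - w x) ∂m ≤ 0 := by
  set A : Set X := {x | k < w x} with hA
  have hAm : MeasurableSet A := measurableSet_lt measurable_const (Lp.stronglyMeasurable w).measurable
  have hAfin : m A ≠ ∞ := by
    have := (Lp.memLp w).meas_ge_lt_top (by simp) (by simp) (ε := k.toNNReal) (by simpa using hk)
    refine ((measure_mono fun x hx => ?_).trans_lt this).ne
    have hx : k < w x := hx
    simp only [mem_ofPred_eq, ← NNReal.coe_le_coe, coe_nnnorm, Real.coe_toNNReal _ hk.le]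
    exact hx.le.trans (le_abs_self _)
  have hint : ∀ f : Lp ℝ 2 m, IntegrableOn f A m := fun f =>
    integrableOn_Lp_of_measure_ne_top f (by norm_num) hAfin
  set v : Lp ℝ 2 m := (LipschitzWith.id.min_const k).compLp (by simpa using hk.le) w with hvdef
  have hv : v =ᵐ[m] fun x => min (w x) k := (LipschitzWith.id.min_const k).coeFn_compLp _ w
  rw [← Lp.coeFn_nonneg] at hw
  have hTv := hM.ae_abs_le ht hT0 (w := v) (k := k) <| by
    filter_upwards [hv, hw] with x hx h0
    simp only [Pi.zero_apply] at h0
    rw [hx, abs_of_nonneg (le_min h0 hk.le)]; exact min_le_right _ _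
  have hwv : (w - v : Lp ℝ 2 m) =ᵐ[m] A.indicator (fun x => w x - k) := by
    filter_upwards [hv, Lp.coeFn_sub w v] with x h1 h2
    rw [h2, Pi.sub_apply, h1]
    by_cases hx : k < w x
    · rw [indicator_of_mem (show x ∈ A from hx), min_eq_right hx.le]
    · rw [indicator_of_notMem (show x ∉ A from hx), min_eq_left (not_lt.mp hx), sub_self]
  have hk_int : IntegrableOn (fun _ => k) A m := integrableOn_const hAfin
  have hwvi : Integrable (w - v : Lp ℝ 2 m) m :=
    (integrable_congr hwv).mpr ((integrable_indicator_iff hAm).mpr ((hint w).sub hk_int))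
  have hc := hM.contraction t ht 1 le_rfl w v
  have hwv1 := hwvi
  rw [← memLp_one_iff_integrable] at hwv1
  have hTi : Integrable (T t w - T t v : Lp ℝ 2 m) m := by
    rw [← memLp_one_iff_integrable]
    exact ⟨Lp.aestronglyMeasurable _, hc.trans_lt hwv1.2⟩
  have hL1 : ∫ x, ‖(T t w - T t v : Lp ℝ 2 m) x‖ ∂m ≤ ∫ x, ‖(w - v : Lp ℝ 2 m) x‖ ∂m := by
    rw [integral_norm_eq_lintegral_enorm (Lp.aestronglyMeasurable _),
      integral_norm_eq_lintegral_enorm (Lp.aestronglyMeasurable _),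
      ← eLpNorm_one_eq_lintegral_enorm, ← eLpNorm_one_eq_lintegral_enorm]
    exact ENNReal.toReal_mono hwv1.2.ne hc
  have hR : ∫ x, ‖(w - v : Lp ℝ 2 m) x‖ ∂m = ∫ x in A, (w x - k) ∂m := by
    rw [← integral_indicator hAm]
    refine integral_congr_ae ?_
    filter_upwards [hwv] with x hx
    rw [hx, Real.norm_of_nonneg]
    exact indicator_nonneg (fun y (hy : k < w y) => (sub_pos.mpr hy).le) x
  calc ∫ x in A, (T t w x - w x) ∂m
      ≤ ∫ x in A, (‖(T t w - T t v : Lp ℝ 2 m) x‖ - (w x - k)) ∂m := by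
        refine integral_mono_ae ((hint _).sub (hint _))
          (hTi.norm.integrableOn.sub ((hint w).sub hk_int)) (ae_restrict_of_ae ?_)
        filter_upwards [hTv, Lp.coeFn_sub (T t w) (T t v)] with x h1 h2
        rw [h2, Pi.sub_apply, Real.norm_eq_abs]
        linarith [le_abs_self (T t w x - T t v x), (abs_le.mp h1).2]
    _ = ∫ x in A, ‖(T t w - T t v : Lp ℝ 2 m) x‖ ∂m - ∫ x in A, (w x - k) ∂m :=
        integral_sub hTi.norm.integrableOn ((hint w).sub hk_int)
    _ ≤ 0 := by
        have := setIntegral_le_integral (s := A) hTi.norm (Eventually.of_forall fun x => norm_nonneg _)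
        linarith

end Flow

/-! ### A signed layer-cake inequality -/

section LayerCake

variable {X : Type*} [MeasurableSpace X] {m : Measure X}

/-- If the integral of `g` over every superlevel set of `b ≥ 0` is nonpositive, so is that of
`g * b`. -/
theorem integral_mul_nonpos_of_setIntegral_nonpos [SFinite m] {g b : X → ℝ}
    (hg : AEStronglyMeasurable g m) (hb : Measurable b) (hb0 : ∀ x, 0 ≤ b x)
    (hgb : Integrable (fun x => g x * b x) m)
    (h : ∀ s, 0 < s → ∫ x in {x | s < b x}, g x ∂m ≤ 0) : ∫ x, g x * b x ∂m ≤ 0 := by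
  have hslice : ∀ (x : X) (c : ℝ), ∫ s in Ioi (0 : ℝ), (Iio (b x)).indicator (fun _ => c) s
      = c * b x := by
    intro x c
    rw [integral_indicator measurableSet_Iio, Measure.restrict_restrict measurableSet_Iio,
      setIntegral_const, Iio_inter_Ioi, measureReal_def, Real.volume_Ioo, sub_zero,
      ENNReal.toReal_ofReal (hb0 x), smul_eq_mul, mul_comm]
  -- Integrating `F` in `s > 0` first gives `g * b`; integrating in `x` first gives the superlevel
  -- integrals of the hypothesis.
  set F : X × ℝ → ℝ := {p : X × ℝ | p.2 < b p.1}.indicator (fun p => g p.1) with hF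
  have hmeas : MeasurableSet {p : X × ℝ | p.2 < b p.1} :=
    measurableSet_lt measurable_snd (hb.comp measurable_fst)
  have hFx : ∀ x s, F (x, s) = (Iio (b x)).indicator (fun _ => g x) s := fun x s => by
    simp only [hF, indicator, mem_ofPred_eq, mem_Iio]
  have hFm : AEStronglyMeasurable F (m.prod (volume.restrict (Ioi 0))) :=
    (hg.comp_fst).indicator hmeas
  have hFi : Integrable F (m.prod (volume.restrict (Ioi 0))) := by
    rw [integrable_prod_iff hFm]
    refine ⟨Eventually.of_forall fun x => ?_, ?_⟩
    · simp only [hFx]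
      rw [integrable_indicator_iff measurableSet_Iio, IntegrableOn,
        Measure.restrict_restrict measurableSet_Iio]
      exact integrableOn_const (by simp [Iio_inter_Ioi])
    · simp only [hFx, norm_indicator_eq_indicator_norm]
      simp only [hslice]
      refine hgb.norm.congr (Eventually.of_forall fun x => ?_)
      simp only [norm_mul, Real.norm_of_nonneg (hb0 x)]
  have h1 : ∫ x, g x * b x ∂m = ∫ x, (∫ s in Ioi (0 : ℝ), F (x, s)) ∂m := by
    simp only [hFx, hslice]
  rw [h1, integral_integral_swap (f := fun x s => F (x, s)) hFi]
  refine setIntegral_nonpos measurableSet_Ioi fun s hs => ?_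
  have e : (fun x => F (x, s)) = {x | s < b x}.indicator g := by
    ext x; simp only [hF, indicator, mem_ofPred_eq]
  rw [e, integral_indicator (measurableSet_lt measurable_const hb)]
  exact h s hs

end LayerCake

/-! ### Energy decrease under monotone contractions -/

section Contraction

variable {X : Type*} [MeasurableSpace X] {m : Measure X} {E : Lp ℝ 2 m → ℝ≥0∞}
  {T : ℝ → Lp ℝ 2 m → Lp ℝ 2 m}

/-- Both `w = ψ ∘ u` and `u - w` are strictly increasing functions of `u`, so each set `{u - w > s}`
with `s > 0` is some `{w > k}` with `k > 0`. On those sets the `L^1` estimate applies. -/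
theorem le_of_strictMono_comp [SigmaFinite m] (hT : IsGradientFlow E T) (hM : IsMarkov T)
    (hlsc : LowerSemicontinuous E) (h0 : E 0 = 0) {K : ℝ≥0} {ψ : ℝ → ℝ} (hψ : LipschitzWith K ψ)
    (hψ0 : ψ 0 = 0) (hmono : StrictMono ψ) (hmono' : StrictMono fun x => x - ψ x)
    (hsurj : ∀ s, 0 < s → ∃ a, a - ψ a = s) {u : Lp ℝ 2 m} (hu : 0 ≤ u) :
    E (hψ.compLp hψ0 u) ≤ E u := by
  set w := hψ.compLp hψ0 u with hwdef
  have hw : w =ᵐ[m] fun x => ψ (u x) := hψ.coeFn_compLp hψ0 u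
  rw [← Lp.coeFn_nonneg] at hu
  have hw0 : 0 ≤ w := by
    rw [← Lp.coeFn_nonneg]
    filter_upwards [hw, hu] with x h1 h2
    rw [h1, Pi.zero_apply, ← hψ0]
    exact hmono.monotone h2
  refine hT.le_of_inner_nonpos hlsc fun t ht => ?_
  have hT0 := hT.map_zero h0 ht.le
  -- The layer-cake lemma needs nonnegativity everywhere, while `u ≥ 0` holds only almost
  -- everywhere; the maximum changes nothing up to a null set.
  set b : X → ℝ := fun x => max (u x - ψ (u x)) 0 with hbdef
  have hum : Measurable u := (Lp.stronglyMeasurable u).measurable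
  have hbm : Measurable b := (hum.sub (hψ.continuous.measurable.comp hum)).max measurable_const
  have hb : (u - w : Lp ℝ 2 m) =ᵐ[m] b := by
    filter_upwards [hw, hu, Lp.coeFn_sub u w] with x h1 h2 h3
    rw [h3, Pi.sub_apply, h1]
    refine (max_eq_left ?_).symm
    have := hmono'.monotone h2
    simpa [hψ0] using this
  have hprod : (fun x => inner ℝ ((T t w - w : Lp ℝ 2 m) x) ((u - w : Lp ℝ 2 m) x)) =ᵐ[m]
      fun x => (T t w - w : Lp ℝ 2 m) x * b x := by
    filter_upwards [hb] with x hx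
    rw [hx]; simp [mul_comm]
  rw [L2.inner_def, integral_congr_ae hprod]
  refine integral_mul_nonpos_of_setIntegral_nonpos (Lp.aestronglyMeasurable _) hbm
    (fun x => le_max_right _ _) ((L2.integrable_inner _ _).congr hprod) fun s hs => ?_
  obtain ⟨a, ha⟩ := hsurj s hs
  have ha0 : 0 < a := by
    refine hmono'.lt_iff_lt.mp ?_
    simpa [hψ0, ha] using hs
  have hk : 0 < ψ a := hψ0 ▸ hmono ha0
  have hset : {x | s < b x} =ᵐ[m] {x | ψ a < w x} := by
    filter_upwards [hw] with x hx
    refine propext ?_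
    change s < b x ↔ ψ a < w x
    rw [hx, hmono.lt_iff_lt, hbdef, lt_max_iff, or_iff_left hs.le.not_gt]
    conv_lhs => rw [← ha]
    exact hmono'.lt_iff_lt (a := a) (b := u x)
  rw [setIntegral_congr_set hset,
    setIntegral_congr_ae (g := fun x => T t w x - w x)
      (measurableSet_lt measurable_const (Lp.stronglyMeasurable w).measurable)
      ((Lp.coeFn_sub (T t w) w).mono fun x hx _ => hx)]
  exact hM.setIntegral_sub_nonpos ht.le hT0 hw0 hk

end Contraction

/-! ### Predual of a space whose unit ball is closed in a Hilbert space -/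

section Predual

variable {V H : Type u} [NormedAddCommGroup V] [NormedSpace ℝ V] [NormedAddCommGroup H]
  [InnerProductSpace ℝ H]

/-- The transpose of `j : V → H`, with `H` identified with its dual. -/
noncomputable def innerTranspose (j : V →L[ℝ] H) : H →ₗ[ℝ] StrongDual ℝ V where
  toFun h := (innerSL ℝ h).comp j
  map_add' _ _ := by ext; simp
  map_smul' _ _ := by ext; simp

theorem innerTranspose_apply (j : V →L[ℝ] H) (h : H) (v : V) :
    innerTranspose j h v = inner ℝ h (j v) := rfl

/-- If the image of the unit ball is closed, then `j '' closedBall 0 c` is its own bipolar. -/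
theorem exists_preimage_of_inner_le [CompleteSpace H] {j : V →L[ℝ] H}
    (hclosed : IsClosed (j '' Metric.closedBall 0 1)) {u : H} {c : ℝ} (hc : 0 ≤ c)
    (hu : ∀ h, inner ℝ h u ≤ c * ‖innerTranspose j h‖) : ∃ v, j v = u ∧ ‖v‖ ≤ c := by
  rcases hc.eq_or_lt with rfl | hc
  · refine ⟨0, ?_, by simp⟩
    have := hu u
    rw [zero_mul, real_inner_self_nonpos] at this
    simp [this]
  by_cases hmem : c⁻¹ • u ∈ j '' Metric.closedBall 0 1
  · obtain ⟨v, hv, hvu⟩ := hmem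
    refine ⟨c • v, by rw [map_smul, hvu, smul_inv_smul₀ hc.ne'], ?_⟩
    rw [norm_smul, Real.norm_of_nonneg hc.le]
    exact mul_le_of_le_one_right hc.le (by simpa using hv)
  exfalso
  -- A separating vector `h` satisfies `(h, j v) < s < (h, u) / c` on the unit ball. By symmetry of
  -- the ball its transpose has norm at most `s`, contradicting `hu h`.
  obtain ⟨f, s, hs, hsu⟩ := geometric_hahn_banach_closed_point
    ((convex_closedBall (0 : V) 1).linear_image (j : V →ₗ[ℝ] H)) hclosed hmem
  set h := (InnerProductSpace.toDual ℝ H).symm f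
  have hf : ∀ x, f x = inner ℝ h x := fun x => (InnerProductSpace.toDual_symm_apply).symm
  have hball : ∀ v : V, ‖v‖ ≤ 1 → inner ℝ h (j v) < s := fun v hv => by
    rw [← hf]; exact hs _ ⟨v, by simpa using hv, rfl⟩
  have hs0 : 0 < s := by simpa using hball 0 (by simp)
  have hnorm : ‖innerTranspose j h‖ ≤ s := by
    refine ContinuousLinearMap.opNorm_le_of_unit_norm hs0.le fun v hv => ?_
    rw [innerTranspose_apply, Real.norm_eq_abs, abs_le]
    have h1 := hball v hv.le
    have h2 := hball (-v) (by rw [norm_neg, hv])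
    rw [map_neg, inner_neg_right] at h2
    exact ⟨by linarith, h1.le⟩
  rw [hf, inner_smul_right, inv_mul_eq_div, lt_div_iff₀ hc] at hsu
  nlinarith [hu h]

/-- The map is evaluation. A functional on `Y` pulls back along `ι` to `H`, where Riesz represents
it by some `u`; the bipolar lemma places `u` in the range of `j`, and density finishes. The same
lemma gives the lower norm bound. -/
theorem exists_linearEquiv_dual {Y : Type*} [NormedAddCommGroup Y] [NormedSpace ℝ Y]
    [CompleteSpace H] {j : V →L[ℝ] H} (hj : Function.Injective j)
    (hclosed : IsClosed (j '' Metric.closedBall 0 1)) (i : Y →ₗᵢ[ℝ] StrongDual ℝ V)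
    (ι : H →ₗ[ℝ] Y) (hι : ∀ h, i (ι h) = innerTranspose j h) (hdense : DenseRange ι) :
    ∃ Φ : V ≃ₗ[ℝ] StrongDual ℝ Y, ∀ v, ‖Φ v‖ = ‖v‖ := by
  have hιnorm : ∀ h, ‖ι h‖ = ‖innerTranspose j h‖ := fun h => by rw [← hι, i.norm_map]
  let Φ : V →ₗ[ℝ] StrongDual ℝ Y :=
    { toFun := fun v => (NormedSpace.inclusionInDoubleDual ℝ V v).comp i.toContinuousLinearMap
      map_add' := fun _ _ => by ext; simp
      map_smul' := fun _ _ => by ext; simp }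
  have hΦ : ∀ v y, Φ v y = i y v := fun v y => rfl
  have hΦι : ∀ v h, Φ v (ι h) = inner ℝ h (j v) := fun v h => by
    rw [hΦ, hι, innerTranspose_apply]
  have hnorm : ∀ v, ‖Φ v‖ = ‖v‖ := by
    intro v
    refine le_antisymm ?_ ?_
    · refine ContinuousLinearMap.opNorm_le_bound _ (norm_nonneg _) fun y => ?_
      rw [hΦ, mul_comm, ← i.norm_map]
      exact (i y).le_opNorm v
    · obtain ⟨v', hv', hle⟩ := exists_preimage_of_inner_le hclosed (norm_nonneg (Φ v)) (u := j v)
        fun h => by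
          rw [← hΦι, ← hιnorm]
          exact (le_abs_self _).trans ((Φ v).le_opNorm (ι h))
      rwa [hj hv'] at hle
  have hinj : Function.Injective Φ := by
    rw [injective_iff_map_eq_zero]
    intro v hv
    rw [← norm_eq_zero, ← hnorm, hv, norm_zero]
  have hsurj : Function.Surjective Φ := by
    intro l
    have hbound : ∀ h, ‖(l : Y →ₗ[ℝ] ℝ).comp ι h‖ ≤ ‖l‖ * ‖j‖ * ‖h‖ := by
      intro h
      refine (l.le_opNorm (ι h)).trans ?_
      rw [mul_assoc, hιnorm, mul_comm ‖j‖]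
      refine mul_le_mul_of_nonneg_left ?_ (norm_nonneg _)
      exact (ContinuousLinearMap.opNorm_comp_le _ _).trans_eq (by rw [innerSL_apply_norm])
    set g : StrongDual ℝ H := ((l : Y →ₗ[ℝ] ℝ).comp ι).mkContinuous _ hbound
    set u := (InnerProductSpace.toDual ℝ H).symm g
    have hu : ∀ h, inner ℝ h u = l (ι h) := fun h => by
      rw [real_inner_comm]; exact InnerProductSpace.toDual_symm_apply
    obtain ⟨v, hv, -⟩ := exists_preimage_of_inner_le hclosed (norm_nonneg l) (u := u) fun h => by
      rw [hu, ← hιnorm]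
      exact (le_abs_self _).trans (l.le_opNorm (ι h))
    refine ⟨v, ContinuousLinearMap.coeFn_injective ?_⟩
    refine hdense.equalizer (Φ v).continuous l.continuous (funext fun h => ?_)
    simp only [Function.comp_apply]
    rw [hΦι, hv, hu]
  exact ⟨LinearEquiv.ofBijective Φ ⟨hinj, hsurj⟩, hnorm⟩

/-- A normed space that embeds continuously into a Hilbert space, with closed unit ball, is a
dual space. -/
theorem exists_predual [CompleteSpace H] (j : V →L[ℝ] H) (hj : Function.Injective j)
    (hclosed : IsClosed (j '' Metric.closedBall 0 1)) :
    ∃ (Y : Type u) (_ : NormedAddCommGroup Y) (_ : NormedSpace ℝ Y) (_ : CompleteSpace Y)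
      (Φ : V ≃ₗ[ℝ] StrongDual ℝ Y), ∀ v, ‖Φ v‖ = ‖v‖ := by
  let Y : Submodule ℝ (StrongDual ℝ V) := (innerTranspose j).range.topologicalClosure
  have hι : ∀ h, innerTranspose j h ∈ Y := fun h =>
    Submodule.le_topologicalClosure _ (LinearMap.mem_range_self _ h)
  let ι : H →ₗ[ℝ] Y := (innerTranspose j).codRestrict Y hι
  have hdense : DenseRange ι := by
    refine Subtype.dense_iff.mpr fun y hy => ?_
    refine closure_mono ?_ hy
    rintro _ ⟨h, rfl⟩
    exact ⟨ι h, ⟨h, rfl⟩, rfl⟩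
  exact ⟨Y, Y.normedAddCommGroup, Y.normedSpace,
    (Submodule.isClosed_topologicalClosure _).completeSpace_coe,
    exists_linearEquiv_dual hj hclosed Y.subtypeₗᵢ ι (fun _ => rfl) hdense⟩

theorem IsNorm.exists_predual {V : Type u} [AddCommGroup V] [Module ℝ V] {N : V → ℝ}
    (hN : IsNorm N) [CompleteSpace H] (j : V →ₗ[ℝ] H) (hj : Function.Injective j)
    (hle : ∀ v, ‖j v‖ ≤ N v) (hclosed : IsClosed (j '' {v | N v ≤ 1})) :
    ∃ (Y : Type u) (_ : NormedAddCommGroup Y) (_ : NormedSpace ℝ Y) (_ : CompleteSpace Y)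
      (Φ : V ≃ₗ[ℝ] StrongDual ℝ Y), ∀ v, ‖Φ v‖ = N v := by
  let : Norm V := ⟨N⟩
  have core : NormedSpace.Core ℝ V :=
    { norm_nonneg := hN.nonneg
      norm_smul := hN.smul
      norm_triangle := hN.add_le
      norm_eq_zero_iff := hN.eq_zero_iff }
  let : NormedAddCommGroup V := NormedAddCommGroup.ofCore core
  let : NormedSpace ℝ V := NormedSpace.ofCore core
  have hball : {v | N v ≤ 1} = Metric.closedBall (0 : V) 1 := by
    ext v; rw [mem_closedBall_zero_iff]; rfl
  rw [hball] at hclosed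
  exact NonlinearDirichlet.exists_predual (j.mkContinuous 1 fun v => (hle v).trans_eq (one_mul (N v)).symm) hj
    hclosed

end Predual

/-! ### The energy norm: triangle inequality, completeness, Hilbert criterion, predual -/

section EnergyNorm

variable {X : Type*} [MeasurableSpace X] {m : Measure X} {E : Lp ℝ 2 m → ℝ≥0∞}

theorem IsTwoHomogeneous.smul_mem (hE2 : IsTwoHomogeneous E) (c : ℝ) {u : Lp ℝ 2 m}
    (hu : u ∈ domain E) : c • u ∈ domain E := by
  simp only [domain, mem_ofPred_eq, hE2 c u] at hu ⊢
  exact ENNReal.mul_ne_top ENNReal.ofReal_ne_top hu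

theorem IsTwoHomogeneous.toReal_smul (hE2 : IsTwoHomogeneous E) (c : ℝ) (u : Lp ℝ 2 m) :
    (E (c • u)).toReal = c ^ 2 * (E u).toReal := by
  rw [hE2, ENNReal.toReal_mul, ENNReal.toReal_ofReal (sq_nonneg c)]

/-- Convexity applied to `u + v = a (a⁻¹ u) + b (b⁻¹ v)`, with `a * a⁻² = a⁻¹` from homogeneity. -/
theorem IsTwoHomogeneous.add_le (hE2 : IsTwoHomogeneous E) (hconv : ConvexOn ℝ≥0 univ E)
    {a b : ℝ} (ha : 0 < a) (hb : 0 < b) (hab : a + b = 1) (u v : Lp ℝ 2 m) :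
    E (u + v) ≤ ENNReal.ofReal a⁻¹ * E u + ENNReal.ofReal b⁻¹ * E v := by
  have key : ∀ {c : ℝ} (hc : 0 < c) (w : Lp ℝ 2 m), c.toNNReal • (c⁻¹ • w) = w ∧
      c.toNNReal • E (c⁻¹ • w) = ENNReal.ofReal c⁻¹ * E w := by
    intro c hc w
    refine ⟨by rw [NNReal.smul_def, Real.coe_toNNReal _ hc.le, smul_inv_smul₀ hc.ne'], ?_⟩
    rw [hE2, ENNReal.smul_def, smul_eq_mul, ← mul_assoc]
    change ENNReal.ofReal c * _ * _ = _
    rw [← ENNReal.ofReal_mul hc.le]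
    congr 2
    field_simp
  have h := hconv.2 (mem_univ (a⁻¹ • u)) (mem_univ (b⁻¹ • v)) 
    (zero_le (a := a.toNNReal)) (zero_le (a := b.toNNReal)) (by rw [← Real.toNNReal_add ha.le hb.le, hab, Real.toNNReal_one])
  rwa [(key ha u).1, (key ha u).2, (key hb v).1, (key hb v).2] at h

theorem IsTwoHomogeneous.add_mem (hE2 : IsTwoHomogeneous E) (hconv : ConvexOn ℝ≥0 univ E)
    {u v : Lp ℝ 2 m} (hu : u ∈ domain E) (hv : v ∈ domain E) : u + v ∈ domain E :=
  ((hE2.add_le hconv one_half_pos one_half_pos (add_halves 1) u v).trans_lt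
    (ENNReal.add_lt_top.mpr ⟨ENNReal.mul_lt_top ENNReal.ofReal_lt_top (Ne.lt_top hu),
      ENNReal.mul_lt_top ENNReal.ofReal_lt_top (Ne.lt_top hv)⟩)).ne

/-- The domain of a convex 2-homogeneous functional, as a subspace of `L²`. -/
def IsTwoHomogeneous.domainSubmodule (hE2 : IsTwoHomogeneous E) (hconv : ConvexOn ℝ≥0 univ E) :
    Submodule ℝ (Lp ℝ 2 m) where
  carrier := domain E
  add_mem' := hE2.add_mem hconv
  zero_mem' := by simp [domain, hE2.map_zero]
  smul_mem' c _ hu := hE2.smul_mem c hu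

theorem IsTwoHomogeneous.toReal_add_le (hE2 : IsTwoHomogeneous E) (hconv : ConvexOn ℝ≥0 univ E)
    {a b : ℝ} (ha : 0 < a) (hb : 0 < b) (hab : a + b = 1) {u v : Lp ℝ 2 m}
    (hu : u ∈ domain E) (hv : v ∈ domain E) :
    (E (u + v)).toReal ≤ a⁻¹ * (E u).toReal + b⁻¹ * (E v).toReal := by
  have h1 := ENNReal.mul_ne_top (ENNReal.ofReal_ne_top (r := a⁻¹)) hu
  have h2 := ENNReal.mul_ne_top (ENNReal.ofReal_ne_top (r := b⁻¹)) hv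
  refine (ENNReal.toReal_mono (ENNReal.add_ne_top.mpr ⟨h1, h2⟩)
    (hE2.add_le hconv ha hb hab u v)).trans_eq ?_
  rw [ENNReal.toReal_add h1 h2, ENNReal.toReal_mul, ENNReal.toReal_mul,
    ENNReal.toReal_ofReal (by positivity), ENNReal.toReal_ofReal (by positivity)]

theorem norm_sq_add_le {F : Type*} [SeminormedAddCommGroup F] {a b : ℝ} (ha : 0 < a) (hb : 0 < b)
    (hab : a + b = 1) (u v : F) : ‖u + v‖ ^ 2 ≤ a⁻¹ * ‖u‖ ^ 2 + b⁻¹ * ‖v‖ ^ 2 := by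
  have h := pow_le_pow_left₀ (norm_nonneg _) (norm_add_le u v) 2
  refine h.trans ?_
  have hne := ha.ne'
  have hne' := hb.ne'
  have e : a⁻¹ * ‖u‖ ^ 2 + b⁻¹ * ‖v‖ ^ 2 - (‖u‖ + ‖v‖) ^ 2
      = (b * ‖u‖ - a * ‖v‖) ^ 2 / (a * b) := by
    field_simp
    rw [eq_sub_of_add_eq hab]
    ring
  have : 0 ≤ (b * ‖u‖ - a * ‖v‖) ^ 2 / (a * b) := by positivity
  linarith

theorem energyNorm_nonneg (u : Lp ℝ 2 m) : 0 ≤ energyNorm E u := Real.sqrt_nonneg _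

theorem energyNorm_sq (u : Lp ℝ 2 m) : energyNorm E u ^ 2 = ‖u‖ ^ 2 + (E u).toReal :=
  Real.sq_sqrt (by positivity)

theorem norm_le_energyNorm (u : Lp ℝ 2 m) : ‖u‖ ≤ energyNorm E u :=
  Real.le_sqrt_of_sq_le (by simp)

theorem IsTwoHomogeneous.energyNorm_add_le (hE2 : IsTwoHomogeneous E)
    (hconv : ConvexOn ℝ≥0 univ E) {u v : Lp ℝ 2 m} (hu : u ∈ domain E) (hv : v ∈ domain E) :
    energyNorm E (u + v) ≤ energyNorm E u + energyNorm E v := by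
  have hzero : ∀ {w : Lp ℝ 2 m}, energyNorm E w ≤ 0 → w = 0 := fun {w} hw =>
    norm_le_zero_iff.mp ((norm_le_energyNorm w).trans hw)
  rcases (energyNorm_nonneg (E := E) u).eq_or_lt with hu0 | hu0
  · rw [← hu0, hzero hu0.ge, zero_add, zero_add]
  rcases (energyNorm_nonneg (E := E) v).eq_or_lt with hv0 | hv0
  · rw [← hv0, hzero hv0.ge, add_zero, add_zero]
  set p := energyNorm E u with hp
  set q := energyNorm E v with hq
  -- These weights optimize the bound: `p² / a + q² / b` attains its minimum `(p + q)²`.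
  have ha : 0 < p / (p + q) := by positivity
  have hb : 0 < q / (p + q) := by positivity
  have hab : p / (p + q) + q / (p + q) = 1 := by field_simp
  have h1 := hE2.toReal_add_le hconv ha hb hab hu hv
  have h2 := norm_sq_add_le ha hb hab u v
  refine Real.sqrt_le_iff.mpr ⟨by positivity, ?_⟩
  calc ‖u + v‖ ^ 2 + (E (u + v)).toReal
      ≤ (p / (p + q))⁻¹ * p ^ 2 + (q / (p + q))⁻¹ * q ^ 2 := by
        rw [hp, hq, energyNorm_sq, energyNorm_sq, ← hp, ← hq]
        linarith
    _ = (p + q) ^ 2 := by field_simp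

theorem IsTwoHomogeneous.energyNorm_smul (hE2 : IsTwoHomogeneous E) (c : ℝ) (u : Lp ℝ 2 m) :
    energyNorm E (c • u) = |c| * energyNorm E u := by
  rw [energyNorm, energyNorm, norm_smul, hE2.toReal_smul, mul_pow, Real.norm_eq_abs, sq_abs,
    ← mul_add, Real.sqrt_mul (sq_nonneg c), Real.sqrt_sq_eq_abs]

theorem isClosed_energyNorm_le (hlsc : LowerSemicontinuous E) {r : ℝ} (hr : 0 ≤ r) :
    IsClosed {u : Lp ℝ 2 m | u ∈ domain E ∧ energyNorm E u ≤ r} := by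
  -- In `ℝ≥0∞` a finite bound already forces `u` into the domain, whereas `energyNorm` reads an
  -- infinite energy as `0`.
  have hG : LowerSemicontinuous fun u : Lp ℝ 2 m => ENNReal.ofReal (‖u‖ ^ 2) + E u :=
    (ENNReal.continuous_ofReal.comp (by fun_prop)).lowerSemicontinuous.add hlsc
  convert hG.isClosed_preimage (ENNReal.ofReal (r ^ 2)) using 1
  ext u
  simp only [mem_ofPred_eq, mem_preimage, mem_Iic, domain]
  constructor
  · rintro ⟨hu, h⟩
    rw [← ENNReal.ofReal_toReal hu, ← ENNReal.ofReal_add (by positivity) (by positivity),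
      ← energyNorm_sq]
    exact ENNReal.ofReal_le_ofReal (pow_le_pow_left₀ (energyNorm_nonneg u) h 2)
  · intro h
    have hu : E u ≠ ∞ := ((le_add_self.trans h).trans_lt ENNReal.ofReal_lt_top).ne
    refine ⟨hu, ?_⟩
    rw [← ENNReal.ofReal_toReal hu, ← ENNReal.ofReal_add (by positivity) (by positivity),
      ← energyNorm_sq, ENNReal.ofReal_le_ofReal_iff (sq_nonneg r)] at h
    exact (pow_le_pow_iff_left₀ (energyNorm_nonneg u) hr two_ne_zero).mp h

variable {D : Submodule ℝ (Lp ℝ 2 m)}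

theorem isNorm_energyNorm (hE2 : IsTwoHomogeneous E) (hconv : ConvexOn ℝ≥0 univ E)
    (hD : (D : Set (Lp ℝ 2 m)) = domain E) : IsNorm fun u : D => energyNorm E u where
  nonneg u := energyNorm_nonneg _
  eq_zero_iff u := by
    constructor
    · intro h
      exact Subtype.ext (norm_le_zero_iff.mp ((norm_le_energyNorm (E := E) (u : Lp ℝ 2 m)).trans h.le))
    · rintro rfl
      simp [energyNorm, hE2.map_zero]
  smul a u := hE2.energyNorm_smul a u
  add_le u v := hE2.energyNorm_add_le hconv (hD ▸ u.2) (hD ▸ v.2)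

theorem isBanach_energyNorm (hE2 : IsTwoHomogeneous E) (hconv : ConvexOn ℝ≥0 univ E)
    (hlsc : LowerSemicontinuous E) (hD : (D : Set (Lp ℝ 2 m)) = domain E) :
    IsBanach fun u : D => energyNorm E u where
  toIsNorm := isNorm_energyNorm hE2 hconv hD
  complete x hx := by
    have hcauchy : CauchySeq fun n => (x n : Lp ℝ 2 m) := by
      refine Metric.cauchySeq_iff.mpr fun ε hε => ?_
      obtain ⟨n₀, hn₀⟩ := hx ε hε
      refine ⟨n₀, fun n hn k hk => ?_⟩
      rw [dist_eq_norm]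
      exact (norm_le_energyNorm (E := E) _).trans_lt (hn₀ n hn k hk)
    obtain ⟨y, hy⟩ := cauchySeq_tendsto_of_complete hcauchy
    -- For fixed `n`, the differences `x n - x k` lie in an energy ball that is closed in `L²`, so
    -- their `L²` limit `x n - y` does too.
    have key : ∀ ε : ℝ, 0 < ε → ∃ n₀ : ℕ, ∀ n ≥ n₀, (x n : Lp ℝ 2 m) - y ∈ domain E ∧
        energyNorm E ((x n : Lp ℝ 2 m) - y) ≤ ε := by
      intro ε hε
      obtain ⟨n₀, hn₀⟩ := hx ε hε
      refine ⟨n₀, fun n hn => ?_⟩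
      refine (isClosed_energyNorm_le hlsc hε.le).mem_of_tendsto (hy.const_sub (x n : Lp ℝ 2 m)) ?_
      filter_upwards [eventually_ge_atTop n₀] with k hk
      exact ⟨hD ▸ (x n - x k).2, (hn₀ n hn k hk).le⟩
    have hyD : y ∈ D := by
      obtain ⟨n₀, hn₀⟩ := key 1 one_pos
      have h1 : (x n₀ : Lp ℝ 2 m) - y ∈ D := by
        rw [← SetLike.mem_coe, hD]; exact (hn₀ n₀ le_rfl).1
      simpa using D.sub_mem (x n₀).2 h1
    refine ⟨⟨y, hyD⟩, Metric.tendsto_atTop.mpr fun ε hε => ?_⟩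
    obtain ⟨n₀, hn₀⟩ := key (ε / 2) (half_pos hε)
    refine ⟨n₀, fun n hn => ?_⟩
    rw [Real.dist_0_eq_abs, abs_of_nonneg (energyNorm_nonneg _)]
    exact (hn₀ n hn).2.trans_lt (half_lt_self hε)

theorem IsHilbert.isQuadratic (hD : (D : Set (Lp ℝ 2 m)) = domain E)
    (h : IsHilbert fun u : D => energyNorm E u) : IsQuadratic E := by
  obtain ⟨-, B, -, hB⟩ := h
  refine ⟨D, B.toQuadraticMap - LinearMap.BilinMap.toQuadraticMap
    ((innerₗ (Lp ℝ 2 m)).domRestrict₁₂ D D), hD,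
    fun u => ?_⟩
  have := hB u
  rw [energyNorm_sq] at this
  rw [sub_apply, LinearMap.BilinMap.toQuadraticMap_apply,
    LinearMap.BilinMap.toQuadraticMap_apply, ← this, eq_sub_iff_add_eq, add_comm]
  exact congrArg (· + _) (real_inner_self_eq_norm_sq (u : Lp ℝ 2 m))

theorem IsQuadratic.isHilbert (hD : (D : Set (Lp ℝ 2 m)) = domain E)
    (hB : IsBanach fun u : D => energyNorm E u) (h : IsQuadratic E) :
    IsHilbert fun u : D => energyNorm E u := by
  obtain ⟨D', Q, hD', hQ⟩ := h
  obtain rfl : D = D' := SetLike.coe_injective (hD.trans hD'.symm)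
  refine ⟨hB, QuadraticMap.associated Q + (innerₗ (Lp ℝ 2 m)).domRestrict₁₂ D D,
    fun u v => ?_, fun u => ?_⟩
  · rw [LinearMap.add_apply, LinearMap.add_apply, LinearMap.add_apply, LinearMap.add_apply,
      QuadraticMap.associated_isSymm ℝ Q u v]
    exact congrArg _ (real_inner_comm (v : Lp ℝ 2 m) u)
  · rw [energyNorm_sq, hQ, LinearMap.add_apply, LinearMap.add_apply,
      QuadraticMap.associated_eq_self_apply ℝ Q u, add_comm]
    exact congrArg _ (real_inner_self_eq_norm_sq (u : Lp ℝ 2 m)).symm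

theorem exists_predual_energyNorm {X : Type u} [MeasurableSpace X] {m : Measure X}
    {E : Lp ℝ 2 m → ℝ≥0∞} {D : Submodule ℝ (Lp ℝ 2 m)} (hE2 : IsTwoHomogeneous E)
    (hconv : ConvexOn ℝ≥0 univ E) (hlsc : LowerSemicontinuous E)
    (hD : (D : Set (Lp ℝ 2 m)) = domain E) :
    ∃ (Y : Type u) (_ : NormedAddCommGroup Y) (_ : NormedSpace ℝ Y) (_ : CompleteSpace Y)
      (Φ : D ≃ₗ[ℝ] StrongDual ℝ Y), ∀ u : D, ‖Φ u‖ = energyNorm E u := by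
  refine (isNorm_energyNorm hE2 hconv hD).exists_predual D.subtype D.injective_subtype
    (fun v => norm_le_energyNorm _) ?_
  convert isClosed_energyNorm_le hlsc zero_le_one using 1
  ext u
  rw [← hD]
  simp [and_comm]

end EnergyNorm

/-! ### Stability of the domain under Lipschitz maps -/

section LipschitzComp

variable {X : Type*} [MeasurableSpace X] {m : Measure X} [SigmaFinite m] {E : Lp ℝ 2 m → ℝ≥0∞}
  {T : ℝ → Lp ℝ 2 m → Lp ℝ 2 m} {D : Submodule ℝ (Lp ℝ 2 m)}

theorem compLp_mem_of_nonneg (hT : IsGradientFlow E T) (hM : IsMarkov T)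
    (hlsc : LowerSemicontinuous E) (h0 : E 0 = 0) (hD : (D : Set (Lp ℝ 2 m)) = domain E)
    {K : ℝ≥0} {φ : ℝ → ℝ} (hφ : LipschitzWith K φ) (hφ0 : φ 0 = 0) {u : Lp ℝ 2 m} (hu : 0 ≤ u)
    (huD : u ∈ D) : hφ.compLp hφ0 u ∈ D := by
  -- This makes `c * φ` Lipschitz with constant `1/4`, so `ψ = id / 2 + c * φ` and `id - ψ` both
  -- have slopes in `[1/4, 3/4]`; `K + 1` covers `K = 0`. Then `φ ∘ u` is recovered linearly from `ψ
  -- ∘ u` and `u`.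
  set c : ℝ := (4 * (K + 1))⁻¹ with hc
  have hc0 : 0 < c := by positivity
  have hcφ : ∀ x y, |c * φ x - c * φ y| ≤ |x - y| / 4 := by
    intro x y
    have h := hφ.dist_le_mul x y
    rw [Real.dist_eq, Real.dist_eq] at h
    rw [← mul_sub, abs_mul, abs_of_pos hc0]
    calc c * |φ x - φ y| ≤ c * ((K + 1) * |x - y|) := by
          refine mul_le_mul_of_nonneg_left (h.trans ?_) hc0.le
          exact mul_le_mul_of_nonneg_right (by linarith) (abs_nonneg _)
      _ = |x - y| / 4 := by rw [hc]; field_simp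
  set ψ : ℝ → ℝ := fun x => x / 2 + c * φ x with hψdef
  have hψ : LipschitzWith 1 ψ := LipschitzWith.of_dist_le_mul fun x y => by
    rw [Real.dist_eq, Real.dist_eq, NNReal.coe_one, one_mul]
    have e : ψ x - ψ y = (x - y) / 2 + (c * φ x - c * φ y) := by simp only [hψdef]; ring
    rw [e]
    refine (abs_add_le _ _).trans ?_
    rw [abs_div, abs_two]
    linarith [hcφ x y, abs_nonneg (x - y)]
  have hψ0 : ψ 0 = 0 := by simp [hψdef, hφ0]
  have hmono : StrictMono ψ := fun x y hxy => by
    have := hcφ x y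
    rw [abs_of_neg (sub_neg.mpr hxy), abs_le] at this
    simp only [hψdef]; linarith
  have hmono' : StrictMono fun x => x - ψ x := fun x y hxy => by
    have := hcφ x y
    rw [abs_of_neg (sub_neg.mpr hxy), abs_le] at this
    simp only [hψdef]; linarith
  have hsurj : ∀ s, 0 < s → ∃ a, a - ψ a = s := by
    intro s hs
    -- The slope is at least `1/4`, so the value `s` is reached before `4 * s`.
    have hcont : ContinuousOn (fun x => x - ψ x) (Icc 0 (4 * s)) :=
      (continuous_id.sub hψ.continuous).continuousOn
    obtain ⟨a, -, ha⟩ := intermediate_value_Icc (by positivity) hcont (show s ∈ Icc _ _ from by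
      have := hcφ (4 * s) 0
      rw [hφ0, mul_zero, sub_zero, sub_zero, abs_of_pos (by positivity : 0 < 4 * s), abs_le] at this
      refine ⟨by simpa [hψ0] using hs.le, ?_⟩
      simp only [hψdef]; linarith)
    exact ⟨a, ha⟩
  have hle := le_of_strictMono_comp hT hM hlsc h0 hψ hψ0 hmono hmono' hsurj hu
  have hmem : ∀ v, v ∈ D ↔ E v ≠ ∞ := fun v => by rw [← SetLike.mem_coe, hD]; rfl
  have hw : hψ.compLp hψ0 u ∈ D := by
    rw [hmem] at huD ⊢
    exact (hle.trans_lt huD.lt_top).ne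
  have e : hφ.compLp hφ0 u = c⁻¹ • (hψ.compLp hψ0 u - (1 / 2 : ℝ) • u) := by
    refine Lp.ext ?_
    filter_upwards [hφ.coeFn_compLp hφ0 u, hψ.coeFn_compLp hψ0 u,
      Lp.coeFn_smul c⁻¹ (hψ.compLp hψ0 u - (1 / 2 : ℝ) • u),
      Lp.coeFn_sub (hψ.compLp hψ0 u) ((1 / 2 : ℝ) • u), Lp.coeFn_smul (1 / 2 : ℝ) u]
      with x h1 h2 h3 h4 h5
    rw [h1, h3, Pi.smul_apply, h4, Pi.sub_apply, h2, h5, Pi.smul_apply]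
    simp only [Function.comp_apply, hψdef, smul_eq_mul]
    field_simp
    ring
  rw [e]
  exact D.smul_mem _ (D.sub_mem hw (D.smul_mem _ huD))

theorem compLp_mem (hT : IsGradientFlow E T) (hM : IsMarkov T)
    (hlsc : LowerSemicontinuous E) (h0 : E 0 = 0) (hD : (D : Set (Lp ℝ 2 m)) = domain E)
    {K : ℝ≥0} {φ : ℝ → ℝ} (hφ : LipschitzWith K φ) (hφ0 : φ 0 = 0) {u : Lp ℝ 2 m}
    (huD : u ∈ D) : hφ.compLp hφ0 u ∈ D := by
  have hmem : ∀ v, v ∈ D ↔ E v ≠ ∞ := fun v => by rw [← SetLike.mem_coe, hD]; rfl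
  have hpos : ∀ v ∈ D, Lp.posPart v ∈ D := fun v hv => by
    rw [hmem] at hv ⊢
    exact ((le_of_posPart hT hM hlsc h0 v).trans_lt hv.lt_top).ne
  have hpos0 : ∀ v : Lp ℝ 2 m, 0 ≤ Lp.posPart v := fun v => by
    rw [← Lp.coeFn_nonneg]
    filter_upwards [Lp.coeFn_posPart v] with x hx
    rw [hx]; exact le_max_right _ _
  have hφ' : LipschitzWith K fun x => φ (-x) := by
    simpa [Function.comp_def] using hφ.comp LipschitzWith.id.neg
  have hφ0' : φ (-0) = 0 := by rw [neg_zero, hφ0]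
  -- The positive and negative parts have disjoint supports and `φ 0 = 0`, so the composition splits
  -- and the nonnegative case applies to each part.
  have e : hφ.compLp hφ0 u =
      hφ.compLp hφ0 (Lp.posPart u) + hφ'.compLp hφ0' (Lp.posPart (-u)) := by
    refine Lp.ext ?_
    filter_upwards [hφ.coeFn_compLp hφ0 u, hφ.coeFn_compLp hφ0 (Lp.posPart u),
      hφ'.coeFn_compLp hφ0' (Lp.posPart (-u)), Lp.coeFn_posPart u, Lp.coeFn_posPart (-u),
      Lp.coeFn_neg u, Lp.coeFn_add (hφ.compLp hφ0 (Lp.posPart u))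
        (hφ'.compLp hφ0' (Lp.posPart (-u)))] with x h1 h2 h3 h4 h5 h6 h7
    rw [h1, h7, Pi.add_apply, h2, h3]
    simp only [Function.comp_apply]
    rw [h4, h5, h6, Pi.neg_apply]
    rcases le_total (u x) 0 with h | h
    · rw [max_eq_right h, max_eq_left (neg_nonneg.mpr h), hφ0, neg_neg, zero_add]
    · rw [max_eq_left h, max_eq_right (neg_nonpos.mpr h), neg_zero, hφ0, add_zero]
  rw [e]
  exact D.add_mem (compLp_mem_of_nonneg hT hM hlsc h0 hD hφ hφ0 (hpos0 u) (hpos u huD))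
    (compLp_mem_of_nonneg hT hM hlsc h0 hD hφ' hφ0' (hpos0 _) (hpos _ (D.neg_mem huD)))

end LipschitzComp

/-! ### The algebra of bounded functions in the domain -/

section Algebra

variable {X : Type*} [MeasurableSpace X] {m : Measure X}

/-- The essentially bounded elements of a subspace of `L²`. -/
def boundedPart (D : Submodule ℝ (Lp ℝ 2 m)) : Submodule ℝ (X →ₘ[m] ℝ) where
  carrier := {f | (∃ u ∈ D, (u : X →ₘ[m] ℝ) = f) ∧ f ∈ Lp ℝ ∞ m}
  add_mem' := by
    rintro _ _ ⟨⟨u, hu, rfl⟩, hu'⟩ ⟨⟨v, hv, rfl⟩, hv'⟩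
    exact ⟨⟨u + v, D.add_mem hu hv, rfl⟩, add_mem hu' hv'⟩
  zero_mem' := ⟨⟨0, D.zero_mem, rfl⟩, zero_mem _⟩
  smul_mem' := by
    rintro c _ ⟨⟨u, hu, rfl⟩, hu'⟩
    exact ⟨⟨c • u, D.smul_mem c hu, rfl⟩, Lp.const_smul_mem_Lp c ⟨_, hu'⟩⟩

/-- Squaring is not globally Lipschitz; this substitute agrees with it on `[-M, M]`, which suffices
for functions bounded by `M`. -/
theorem lipschitzWith_sq_clip (M : ℝ≥0) :
    LipschitzWith (2 * M) fun x : ℝ => (min (max x (-M)) M) ^ 2 := by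
  refine LipschitzWith.of_dist_le_mul fun x y => ?_
  have hclip : LipschitzWith 1 fun x : ℝ => min (max x (-(M : ℝ))) M :=
    (LipschitzWith.id.max_const _).min_const _
  have h := hclip.dist_le_mul x y
  have hb : ∀ x : ℝ, |min (max x (-(M : ℝ))) M| ≤ M := fun x =>
    abs_le.mpr ⟨le_min (le_max_right _ _) (by linarith [M.coe_nonneg]), min_le_right _ _⟩
  rw [Real.dist_eq, Real.dist_eq, NNReal.coe_one, one_mul] at h
  rw [Real.dist_eq, Real.dist_eq, sq_sub_sq, abs_mul, NNReal.coe_mul, NNReal.coe_ofNat]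
  refine mul_le_mul ?_ h (abs_nonneg _) (by positivity)
  exact (abs_add_le _ _).trans (by linarith [hb x, hb y])

theorem mul_self_mem_boundedPart {D : Submodule ℝ (Lp ℝ 2 m)}
    (hcomp : ∀ (K : ℝ≥0) (φ : ℝ → ℝ) (hφ : LipschitzWith K φ) (hφ0 : φ 0 = 0),
      ∀ u ∈ D, hφ.compLp hφ0 u ∈ D) {f : X →ₘ[m] ℝ} (hf : f ∈ boundedPart D) :
    f * f ∈ boundedPart D := by
  obtain ⟨⟨u, hu, rfl⟩, hb⟩ := hf
  obtain ⟨M, hM⟩ : ∃ M : ℝ≥0, ∀ᵐ x ∂m, |u x| ≤ M := by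
    rw [Lp.mem_Lp_iff_eLpNorm_lt_top, eLpNorm_exponent_top] at hb
    refine ⟨(eLpNormEssSup u m).toNNReal, ?_⟩
    filter_upwards [ae_le_eLpNormEssSup (f := u) (μ := m)] with x hx
    rw [← ENNReal.coe_toNNReal hb.ne, enorm_le_coe] at hx
    exact_mod_cast hx
  have h0 : (min (max 0 (-(M : ℝ))) M) ^ 2 = 0 := by simp
  set v := (lipschitzWith_sq_clip M).compLp h0 u
  have hv : v =ᵐ[m] fun x => u x * u x := by
    filter_upwards [(lipschitzWith_sq_clip M).coeFn_compLp h0 u, hM] with x h1 h2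
    rw [h1, Function.comp_apply, max_eq_left (abs_le.mp h2).1, min_eq_left (abs_le.mp h2).2, sq]
  have hvu : (v : X →ₘ[m] ℝ) = u * u := AEEqFun.ext (hv.trans (AEEqFun.coeFn_mul _ _).symm)
  rw [← hvu]
  refine ⟨⟨v, hcomp _ _ _ _ u hu, rfl⟩, ?_⟩
  rw [Lp.mem_Lp_iff_memLp]
  refine memLp_top_of_bound (AEEqFun.aestronglyMeasurable _) (M * M : ℝ) ?_
  filter_upwards [hv, hM] with x h1 h2
  rw [h1, Real.norm_eq_abs, abs_mul]
  exact mul_le_mul h2 h2 (abs_nonneg _) M.coe_nonneg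

theorem mul_mem_boundedPart {D : Submodule ℝ (Lp ℝ 2 m)}
    (hcomp : ∀ (K : ℝ≥0) (φ : ℝ → ℝ) (hφ : LipschitzWith K φ) (hφ0 : φ 0 = 0),
      ∀ u ∈ D, hφ.compLp hφ0 u ∈ D) {f g : X →ₘ[m] ℝ} (hf : f ∈ boundedPart D)
    (hg : g ∈ boundedPart D) : f * g ∈ boundedPart D := by
  -- Polarization reduces products to squares.
  have e : f * g = (1 / 2 : ℝ) • ((f + g) * (f + g) - f * f - g * g) := by
    refine AEEqFun.induction_on₂ f g fun f hf g hg => ?_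
    simp only [AEEqFun.mk_add_mk, AEEqFun.mk_mul_mk, ← AEEqFun.mk_sub]
    congr 1
    ext x
    change f x * g x = 1 / 2 * ((f x + g x) * (f x + g x) - f x * f x - g x * g x)
    ring
  rw [e]
  exact Submodule.smul_mem _ _ (Submodule.sub_mem _ (Submodule.sub_mem _
    (mul_self_mem_boundedPart hcomp (Submodule.add_mem _ hf hg))
    (mul_self_mem_boundedPart hcomp hf)) (mul_self_mem_boundedPart hcomp hg))

end Algebra

end NonlinearDirichlet

theorem mainTheorem1 {X : Type u} [MeasurableSpace X] (m : Measure X) [SigmaFinite m]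
    (E : Lp ℝ 2 m → ℝ≥0∞) (hE : NonlinearDirichlet.IsNonlinearDirichletForm E)
    (hE2 : NonlinearDirichlet.IsTwoHomogeneous E) :
    ∃ D : Submodule ℝ (Lp ℝ 2 m),
      (D : Set (Lp ℝ 2 m)) = NonlinearDirichlet.domain E ∧
      NonlinearDirichlet.IsBanach (fun u : D => NonlinearDirichlet.energyNorm E u) ∧
      (NonlinearDirichlet.IsHilbert (fun u : D => NonlinearDirichlet.energyNorm E u) ↔
        NonlinearDirichlet.IsQuadraticDirichletForm E) ∧
      (∀ (K : ℝ≥0) (φ : ℝ → ℝ) (hφ : LipschitzWith K φ) (hφ0 : φ 0 = 0),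
        ∀ u ∈ D, hφ.compLp hφ0 u ∈ D) ∧
      (∃ A : Submodule ℝ (X →ₘ[m] ℝ),
        (∀ f : X →ₘ[m] ℝ, f ∈ A ↔ (∃ u ∈ D, (u : X →ₘ[m] ℝ) = f) ∧ f ∈ Lp ℝ ∞ m) ∧
        ∀ f ∈ A, ∀ g ∈ A, f * g ∈ A) ∧
      (∃ (Y : Type u) (_ : NormedAddCommGroup Y) (_ : NormedSpace ℝ Y) (_ : CompleteSpace Y)
        (Φ : D ≃ₗ[ℝ] StrongDual ℝ Y),
        ∀ u : D, ‖Φ u‖ = NonlinearDirichlet.energyNorm E u) := by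
  obtain ⟨hconv, hlsc, hdense, T, hT, hM⟩ := hE
  have h0 := hE2.map_zero
  have hD : (hE2.domainSubmodule hconv : Set (Lp ℝ 2 m)) = NonlinearDirichlet.domain E := rfl
  have hB := NonlinearDirichlet.isBanach_energyNorm hE2 hconv hlsc hD
  have hcomp : ∀ (K : ℝ≥0) (φ : ℝ → ℝ) (hφ : LipschitzWith K φ) (hφ0 : φ 0 = 0),
      ∀ u ∈ hE2.domainSubmodule hconv, hφ.compLp hφ0 u ∈ hE2.domainSubmodule hconv :=
    fun K φ hφ hφ0 u hu => NonlinearDirichlet.compLp_mem hT hM hlsc h0 hD hφ hφ0 hu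
  refine ⟨hE2.domainSubmodule hconv, hD, hB, ⟨fun h => ?_, fun h => ?_⟩, hcomp,
    ⟨NonlinearDirichlet.boundedPart _, fun f => Iff.rfl,
      fun f hf g hg => NonlinearDirichlet.mul_mem_boundedPart hcomp hf hg⟩,
    NonlinearDirichlet.exists_predual_energyNorm hE2 hconv hlsc hD⟩
  · exact ⟨h.isQuadratic hD, hlsc, hdense,
      fun u _ => NonlinearDirichlet.le_of_unitClip hT hM hlsc h0 u⟩
  · exact h.quadratic.isHilbert hD hB
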